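/- Let $n\in\mathbb N$ and $T>0$. Consider the operator on $[0,T]\times\mathbb R^n$ $$\mathcal L u=\partial_t u+\sum_{i,j=1}^n\partial_{x_i}\bigl(a_{i,j}(t)\,\partial_{x_j}u\bigr)+\sum_{j=1}^n b_j(t)\,\partial_{x_j}u+c(t)\,u ,$$ whose coefficients depend on time only, $a_{i,j}$ being real valued and $b_j$, $c$ complex valued. A modulus of continuity is a continuous, increasing, concave function $\omega:[0,1]\to[0,1]$ with $\omega(0)=0$ and $\omega(s)>0$ for $s\in(0,1]$; it satisfies the Osgood condition if $\int_0^1\frac{ds}{\omega(s)}=+\infty$. Let $\omega$ be a modulus of continuity that satisfies the Osgood condition, and let $k_A,k_B,k_C>0$. We say that $\mathcal L$ is admissible if * $a_{i,j}(t)=a_{j,i}(t)$ for all $t\in[0,T]$ and all $i,j$; * $k_A|\xi|^2\le\sum_{i,j=1}^n a_{i,j}(t)\xi_i\xi_j\le k_A^{-1}|\xi|^2$ for all $(t,\xi)\in[0,T]\times\mathbb R^n$; * $|b_i(t)|\le k_B$ and $|c(t)|\le k_C$ for all $t\in[0,T]$ and all $i$; * $a_{i,j}\in C^\omega([0,T])$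 for all $i,j$, that is, $\sup\bigl\{|a_{i,j}(t)-a_{i,j}(s)|/\omega(|t-s|) : t,s\in[0,T],\ 0<|t-s|<1\bigr\}<+\infty$. Let $L^2=L^2(\mathbb R^n;\mathbb C)$, $H^1=H^1(\mathbb R^n;\mathbb C)$ and $$\mathcal H_0=C([0,T],L^2)\cap C([0,T),H^1)\cap C^1([0,T),L^2).$$ A function $u\in\mathcal H_0$ is a solution of $\mathcal L u=0$ on $[0,T]$ if the equation holds in the sense of distributions on $\mathbb R^n$ for almost every $t\in(0,T)$. **Theorem.** For every $T'\in(0,T)$ and every $D>0$ there exist $\rho'>0$ and a strictly increasing continuous function $G:[0,+\infty)\to[0,+\infty)$ with $G(0)=0$, depending only on $k_A,k_B,k_C,\omega,n,T,T'$ and $D$, such that the following holds for every admissible operator $\mathcal L$: if $u\in\mathcal H_0$ is a solution of $\mathcal L u=0$ on $[0,T]$ with $\|u(t,\cdot)\|_{L^2}\le D$ for all $t\in[0,T]$ and $\|u(0,\cdot)\|_{L^2}\le\rho'$, then $$\sup_{t\in[0,T']}\|u(t,\cdot)\|_{L^2}^2\le G\bigl(\|u(0,\cdot)\|_{L^2}^2\bigr).$$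 -/

import Mathlib

open MeasureTheory Set
open scoped NNReal ENNReal LineDeriv

namespace BackwardParabolic

/-- Euclidean space of dimension `n`. -/
abbrev Space (n : ℕ) := EuclideanSpace ℝ (Fin n)

/-- The complex Lebesgue space of square integrable functions on Euclidean space. -/
noncomputable abbrev L2 (n : ℕ) := Lp ℂ 2 (volume : Measure (Space n))

/-- The `i`-th vector of the standard basis. -/
noncomputable abbrev e {n : ℕ} (i : Fin n) : Space n := EuclideanSpace.single i (1 : ℝ)

/-- A modulus of continuity: a function `μ : [0,1] → [0,1]`, continuous, increasing, concave, with
`μ 0 = 0`. Only the values on `[0,1]` matter. The increase may be weak, but `μ` is positive on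
`(0,1]`, so that dividing by it makes sense. -/
structure IsModulusOfContinuity (μ : ℝ → ℝ) : Prop where
  mapsTo : MapsTo μ (Icc 0 1) (Icc 0 1)
  continuousOn : ContinuousOn μ (Icc 0 1)
  monotoneOn : MonotoneOn μ (Icc 0 1)
  concaveOn : ConcaveOn ℝ (Icc 0 1) μ
  map_zero : μ 0 = 0
  pos : ∀ s ∈ Ioc (0 : ℝ) 1, 0 < μ s

/-- The Osgood condition: the integral of `1 / μ` over `(0,1)` is infinite. -/
def OsgoodCondition (μ : ℝ → ℝ) : Prop :=
  ∫⁻ s in Ioo (0 : ℝ) 1, ENNReal.ofReal (1 / μ s) = ∞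

/-- `f` has regularity `μ` on `I`: the quotients `|f t - f s| / μ |t - s|` are bounded over
`t, s ∈ I` with `0 < |t - s| < 1`. -/
def HasRegularityOn (μ f : ℝ → ℝ) (I : Set ℝ) : Prop :=
  ∃ C : ℝ, ∀ t ∈ I, ∀ s ∈ I, 0 < |t - s| → |t - s| < 1 → |f t - f s| / μ |t - s| ≤ C

/-- The coefficients, depending on time only, of the operator
`u ↦ ∂ₜ u + ∑ i j, ∂ᵢ (aᵢⱼ(t) ∂ⱼ u) + ∑ j, bⱼ(t) ∂ⱼ u + c(t) u`. -/
structure Coefficients (n : ℕ) where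
  a : Fin n → Fin n → ℝ → ℝ
  b : Fin n → ℝ → ℂ
  c : ℝ → ℂ

/-- The standing assumptions on the coefficients over `[0,T]`, with ellipticity constant `kA`,
bounds `kB`, `kC` for the lower order coefficients, and modulus of continuity `ω` for the
leading ones. -/
structure Coefficients.Admissible {n : ℕ} (L : Coefficients n) (T kA kB kC : ℝ) (ω : ℝ → ℝ) :
    Prop where
  symm : ∀ t ∈ Icc 0 T, ∀ i j, L.a i j t = L.a j i t
  lower : ∀ t ∈ Icc 0 T, ∀ ξ : Space n,
    kA * ‖ξ‖ ^ 2 ≤ ∑ i, ∑ j, L.a i j t * ξ i * ξ j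
  upper : ∀ t ∈ Icc 0 T, ∀ ξ : Space n,
    ∑ i, ∑ j, L.a i j t * ξ i * ξ j ≤ kA⁻¹ * ‖ξ‖ ^ 2
  bound_b : ∀ t ∈ Icc 0 T, ∀ i, ‖L.b i t‖ ≤ kB
  bound_c : ∀ t ∈ Icc 0 T, ‖L.c t‖ ≤ kC
  regularity : ∀ i j, HasRegularityOn ω (L.a i j) (Icc 0 T)

/-- The space `C([0,T], L²) ∩ C([0,T), H¹) ∩ C¹([0,T), L²)`. The derivative of an `L²` function is
taken in the sense of distributions, and continuity into `H¹` means that the function and its first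
partial derivatives are continuous into `L²`. -/
structure MemH0 {n : ℕ} (T : ℝ) (u : ℝ → L2 n) : Prop where
  continuousOn : ContinuousOn u (Icc 0 T)
  continuousOn_H1 : ∃ v : Fin n → ℝ → L2 n, ∀ i, ContinuousOn (v i) (Ico 0 T) ∧
    ∀ t ∈ Ico 0 T, ∂_{e i} (u t : TemperedDistribution (Space n) ℂ) = v i t
  contDiffOn : ContDiffOn ℝ 1 u (Ico 0 T)

/-- The spatial part of the operator at time `t`, acting on tempered distributions. -/
noncomputable def Coefficients.spatial {n : ℕ} (L : Coefficients n) (t : ℝ)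
    (w : TemperedDistribution (Space n) ℂ) : TemperedDistribution (Space n) ℂ :=
  (∑ i, ∑ j, ∂_{e i} ((L.a i j t : ℂ) • ∂_{e j} w)) + (∑ j, L.b j t • ∂_{e j} w) + L.c t • w

/-- `u` solves the homogeneous equation on `[0,T]`: at almost every time, the equation holds in the
sense of distributions on Euclidean space. -/
def Coefficients.IsSolution {n : ℕ} (L : Coefficients n) (T : ℝ) (u : ℝ → L2 n) : Prop :=
  ∀ᵐ t, t ∈ Ioo 0 T →
    ((derivWithin u (Ico 0 T) t : L2 n) : TemperedDistribution (Space n) ℂ) + L.spatial t (u t) = 0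

end BackwardParabolic

namespace BackwardParabolic

open Filter Topology FourierTransform SchwartzMap

/-! Coefficients depending on time only make the equation diagonal under the Fourier transform: `𝓕
u` satisfies `∂ₜ û = -σ(t, ξ) û`, so `|û|²` grows at rate `-2 Re σ`, where `-Re σ` is `4π²` times
the elliptic form up to lower order terms. Let `R` exceed a fixed threshold. On `‖ξ‖ > R` the growth
rate of the energy is at least a multiple of `R²`, so this part at time `t ≤ T'` is exponentially
smaller than at time `T`, where `D` bounds it (`monotoneOn_high_frequency`). On `‖ξ‖ ≤ R` the rate
is at most a multiple of `R²`, so this part is controlled from time `0`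
(`antitoneOn_low_frequency`). The sum has the form `exp (2TKR²) m + D² exp (-cR²)` with `m = ‖u
0‖²`. Taking `R²` proportional to `-log m` balances it into a Hölder-type bound
(`le_sqrt_add_mul_rpow`). -/

/-- Grönwall's inequality from an almost everywhere differential inequality with continuous
derivative. -/
theorem monotoneOn_exp_mul_of_ae_le_deriv {f f' : ℝ → ℝ} {k T : ℝ}
    (hf : ContinuousOn f (Icc 0 T)) (hd : ∀ t ∈ Ioo 0 T, HasDerivAt f (f' t) t)
    (hf' : ContinuousOn f' (Ioo 0 T)) (hae : ∀ᵐ t, t ∈ Ioo 0 T → k * f t ≤ f' t) :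
    MonotoneOn (fun t ↦ Real.exp (-(k * t)) * f t) (Icc 0 T) := by
  have hle : ∀ t ∈ Ioo 0 T, k * f t ≤ f' t := by
    -- By continuity the set where the inequality fails is open; being null, it is empty.
    have hopen : IsOpen (Ioo 0 T ∩ {t | f' t - k * f t < 0}) :=
      (hf'.sub (continuousOn_const.mul (hf.mono Ioo_subset_Icc_self))).isOpen_inter_preimage
        isOpen_Ioo isOpen_Iio
    have hnull : volume (Ioo 0 T ∩ {t | f' t - k * f t < 0}) = 0 := by
      refine measure_mono_null ?_ (ae_iff.mp hae)
      rintro t ⟨ht, hlt⟩ h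
      have hlt : f' t - k * f t < 0 := hlt
      linarith [h ht]
    have hempty := (hopen.measure_eq_zero_iff volume).mp hnull
    intro t ht
    by_contra! h
    exact (hempty ▸ (⟨ht, by simpa using h⟩ : t ∈ Ioo 0 T ∩ {t | f' t - k * f t < 0}) :
      t ∈ (∅ : Set ℝ))
  have hderiv : ∀ t ∈ Ioo 0 T, HasDerivAt (fun t ↦ Real.exp (-(k * t)) * f t)
      (Real.exp (-(k * t)) * (f' t - k * f t)) t := by
    intro t ht
    have h1 : HasDerivAt (fun t : ℝ ↦ Real.exp (-(k * t))) (Real.exp (-(k * t)) * (-k)) t := by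
      simpa using ((hasDerivAt_id t).const_mul k).neg.exp
    exact (h1.mul (hd t ht)).congr_deriv (by ring)
  refine monotoneOn_of_deriv_nonneg (convex_Icc 0 T) ?_ ?_ ?_
  · exact (by fun_prop : Continuous fun t : ℝ ↦ Real.exp (-(k * t))).continuousOn.mul hf
  · rw [interior_Icc]
    exact fun t ht ↦ (hderiv t ht).differentiableAt.differentiableWithinAt
  · rw [interior_Icc]
    intro t ht
    rw [(hderiv t ht).deriv]
    exact mul_nonneg (Real.exp_pos _).le (sub_nonneg.mpr (hle t ht))

/-! ### Growth of `‖A (u t)‖²` for a fixed bounded operator `A` -/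

section HilbertSpace

theorem hasDerivAt_of_contDiffOn_Ico {H : Type*} [NormedAddCommGroup H] [NormedSpace ℝ H]
    {T : ℝ} {u : ℝ → H} (hu : ContDiffOn ℝ 1 u (Ico 0 T))
    {t : ℝ} (ht : t ∈ Ioo 0 T) : HasDerivAt u (derivWithin u (Ico 0 T) t) t :=
  ((hu.differentiableOn one_ne_zero t (Ioo_subset_Ico_self ht)).hasDerivWithinAt).hasDerivAt
    (Ico_mem_nhds ht.1 ht.2)

theorem continuousOn_derivWithin_Ico {H : Type*} [NormedAddCommGroup H] [NormedSpace ℝ H]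
    {T : ℝ} {u : ℝ → H} (hu : ContDiffOn ℝ 1 u (Ico 0 T)) :
    ContinuousOn (derivWithin u (Ico 0 T)) (Ioo 0 T) :=
  (hu.continuousOn_derivWithin (uniqueDiffOn_Ico 0 T) le_rfl).mono Ioo_subset_Ico_self

variable {H H' : Type*} [NormedAddCommGroup H] [NormedSpace ℂ H]
  [NormedAddCommGroup H'] [InnerProductSpace ℂ H'] {T k : ℝ} {u : ℝ → H}

theorem hasDerivAt_norm_sq_comp (A : H →L[ℂ] H') {u' : H} {t : ℝ} (hu : HasDerivAt u u' t) :
    HasDerivAt (fun t ↦ ‖A (u t)‖ ^ 2) (2 * (inner ℂ (A (u t)) (A u')).re) t := by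
  let _ : InnerProductSpace ℝ H' := InnerProductSpace.complexToReal
  have h := ((A.restrictScalars ℝ).hasFDerivAt.comp_hasDerivAt t hu).norm_sq
  simpa [real_inner_eq_re_inner ℂ] using h

/-- Being bounded and independent of time, `A` commutes with `d/dt`. With `A` a frequency
restriction, the equation is integrated in norm rather than for each `ξ`. Continuity of `u` on the
closed interval carries the conclusion up to `T`, where `u` need not be differentiable. -/
theorem monotoneOn_exp_mul_norm_sq (A : H →L[ℂ] H') (huc : ContinuousOn u (Icc 0 T))
    (hu : ContDiffOn ℝ 1 u (Ico 0 T))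
    (hae : ∀ᵐ t, t ∈ Ioo 0 T →
      k * ‖A (u t)‖ ^ 2 ≤ (inner ℂ (A (u t)) (A (derivWithin u (Ico 0 T) t))).re) :
    MonotoneOn (fun t ↦ Real.exp (-(2 * k * t)) * ‖A (u t)‖ ^ 2) (Icc 0 T) := by
  refine monotoneOn_exp_mul_of_ae_le_deriv
    (f' := fun t ↦ 2 * (inner ℂ (A (u t)) (A (derivWithin u (Ico 0 T) t))).re)
    ((A.continuous.comp_continuousOn huc).norm.pow 2)
    (fun t ht ↦ hasDerivAt_norm_sq_comp A (hasDerivAt_of_contDiffOn_Ico hu ht)) ?_ ?_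
  · exact continuousOn_const.mul (Complex.continuous_re.comp_continuousOn
      ((A.continuous.comp_continuousOn (huc.mono Ioo_subset_Icc_self)).inner
        (A.continuous.comp_continuousOn (continuousOn_derivWithin_Ico hu))))
  · filter_upwards [hae] with t h ht
    linarith [h ht]

theorem antitoneOn_exp_mul_norm_sq (A : H →L[ℂ] H') (huc : ContinuousOn u (Icc 0 T))
    (hu : ContDiffOn ℝ 1 u (Ico 0 T))
    (hae : ∀ᵐ t, t ∈ Ioo 0 T →
      (inner ℂ (A (u t)) (A (derivWithin u (Ico 0 T) t))).re ≤ k * ‖A (u t)‖ ^ 2) :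
    AntitoneOn (fun t ↦ Real.exp (-(2 * k * t)) * ‖A (u t)‖ ^ 2) (Icc 0 T) := by
  have h := monotoneOn_exp_mul_of_ae_le_deriv (f := fun t ↦ -‖A (u t)‖ ^ 2) (k := 2 * k)
    (f' := fun t ↦ -(2 * (inner ℂ (A (u t)) (A (derivWithin u (Ico 0 T) t))).re))
    ((A.continuous.comp_continuousOn huc).norm.pow 2).neg
    (fun t ht ↦ (hasDerivAt_norm_sq_comp A (hasDerivAt_of_contDiffOn_Ico hu ht)).neg) ?_ ?_
  · intro s hs t ht hst
    have := h hs ht hst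
    simp only [mul_neg] at this
    exact neg_le_neg_iff.mp this
  · exact (continuousOn_const.mul (Complex.continuous_re.comp_continuousOn
      ((A.continuous.comp_continuousOn (huc.mono Ioo_subset_Icc_self)).inner
        (A.continuous.comp_continuousOn (continuousOn_derivWithin_Ico hu))))).neg
  · filter_upwards [hae] with t h ht
    linarith [h ht]

end HilbertSpace

/-! ### From pointwise to integrated inequalities in `L²` -/

section L2

variable {α : Type*} [MeasurableSpace α] {μ : Measure α}

theorem integrable_re_inner (f g : Lp ℂ 2 μ) :
    Integrable (fun x ↦ (inner ℂ (f x) (g x)).re) μ :=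
  (L2.integrable_inner (𝕜 := ℂ) f g).re

theorem re_inner_eq_integral (f g : Lp ℂ 2 μ) :
    (inner ℂ f g).re = ∫ x, (inner ℂ (f x) (g x)).re ∂μ := by
  rw [L2.inner_def]
  exact (integral_re (L2.integrable_inner (𝕜 := ℂ) f g)).symm

theorem norm_sq_eq_integral (f : Lp ℂ 2 μ) : ‖f‖ ^ 2 = ∫ x, ‖f x‖ ^ 2 ∂μ := by
  rw [← inner_self_eq_norm_sq (𝕜 := ℂ) f]
  refine (re_inner_eq_integral f f).trans (integral_congr_ae (ae_of_all _ fun x ↦ ?_))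
  exact inner_self_eq_norm_sq (𝕜 := ℂ) (f x)

theorem integrable_norm_sq (f : Lp ℂ 2 μ) : Integrable (fun x ↦ ‖f x‖ ^ 2) μ :=
  (Lp.memLp f).integrable_norm_pow two_ne_zero

theorem mul_norm_sq_le_re_inner {k : ℝ} (f g : Lp ℂ 2 μ)
    (h : ∀ᵐ x ∂μ, k * ‖f x‖ ^ 2 ≤ (inner ℂ (f x) (g x)).re) :
    k * ‖f‖ ^ 2 ≤ (inner ℂ f g).re := by
  rw [norm_sq_eq_integral, re_inner_eq_integral, ← integral_const_mul]
  exact integral_mono_ae ((integrable_norm_sq f).const_mul k) (integrable_re_inner f g) h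

theorem re_inner_le_mul_norm_sq {k : ℝ} (f g : Lp ℂ 2 μ)
    (h : ∀ᵐ x ∂μ, (inner ℂ (f x) (g x)).re ≤ k * ‖f x‖ ^ 2) :
    (inner ℂ f g).re ≤ k * ‖f‖ ^ 2 := by
  rw [norm_sq_eq_integral, re_inner_eq_integral, ← integral_const_mul]
  exact integral_mono_ae (integrable_re_inner f g) ((integrable_norm_sq f).const_mul k) h

theorem norm_sq_restrict (f : Lp ℂ 2 μ) (s : Set α) :
    ‖LpToLpRestrictCLM α ℂ ℂ μ 2 s f‖ ^ 2 = ∫ x in s, ‖f x‖ ^ 2 ∂μ := by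
  rw [norm_sq_eq_integral]
  refine integral_congr_ae ?_
  filter_upwards [LpToLpRestrictCLM_coeFn ℂ s f] with x hx
  rw [hx]

theorem norm_sq_restrict_add_compl (f : Lp ℂ 2 μ) {s : Set α} (hs : MeasurableSet s) :
    ‖LpToLpRestrictCLM α ℂ ℂ μ 2 s f‖ ^ 2 + ‖LpToLpRestrictCLM α ℂ ℂ μ 2 sᶜ f‖ ^ 2 =
      ‖f‖ ^ 2 := by
  rw [norm_sq_restrict, norm_sq_restrict, norm_sq_eq_integral]
  exact integral_add_compl hs (integrable_norm_sq f)

end L2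

/-! ### The Fourier symbol and its bounds -/

section Symbol

variable {n : ℕ}

/-- The Fourier multiplier of the spatial part of the operator at time `t`. -/
noncomputable def Coefficients.symbol (L : Coefficients n) (t : ℝ) (ξ : Space n) : ℂ :=
  (∑ i, ∑ j, (L.a i j t : ℂ) * ((2 * Real.pi * Complex.I * ξ i) * (2 * Real.pi * Complex.I * ξ j)))
    + (∑ j, L.b j t * (2 * Real.pi * Complex.I * ξ j)) + L.c t

theorem hasTemperateGrowth_coord (i : Fin n) :
    Function.HasTemperateGrowth (fun ξ : Space n ↦ 2 * Real.pi * Complex.I * (ξ i : ℂ)) := by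
  have h : Function.HasTemperateGrowth (fun ξ : Space n ↦ inner ℝ ξ (e i)) := by fun_prop
  have h' : Function.HasTemperateGrowth
      (fun ξ : Space n ↦ 2 * Real.pi * Complex.I * ((inner ℝ ξ (e i) : ℝ) : ℂ)) := by fun_prop
  simpa [EuclideanSpace.inner_single_right] using h'

theorem Coefficients.hasTemperateGrowth_symbol (L : Coefficients n) (t : ℝ) :
    Function.HasTemperateGrowth (L.symbol t) := by
  have h := hasTemperateGrowth_coord (n := n)
  unfold Coefficients.symbol
  fun_prop

theorem fourier_lineDerivOp_single (w : TemperedDistribution (Space n) ℂ) (i : Fin n) :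
    𝓕 (∂_{e i} w) = TemperedDistribution.smulLeftCLM ℂ
      (fun ξ : Space n ↦ 2 * Real.pi * Complex.I * (ξ i : ℂ)) (𝓕 w) := by
  have h : Function.HasTemperateGrowth (fun ξ : Space n ↦ ((inner ℝ ξ (e i) : ℝ) : ℂ)) := by
    fun_prop
  rw [TemperedDistribution.fourier_lineDerivOp_eq, ← smul_apply,
    ← TemperedDistribution.smulLeftCLM_smul h]
  congr 2
  ext ξ
  simp [EuclideanSpace.inner_single_right]

theorem Coefficients.fourier_spatial (L : Coefficients n) (t : ℝ)
    (w : TemperedDistribution (Space n) ℂ) :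
    𝓕 (L.spatial t w) = TemperedDistribution.smulLeftCLM ℂ (L.symbol t) (𝓕 w) := by
  have hsum : ∀ (f : Fin n → TemperedDistribution (Space n) ℂ), 𝓕 (∑ i, f i) = ∑ i, 𝓕 (f i) :=
    fun f ↦ map_sum (fourierCLM ℂ (TemperedDistribution (Space n) ℂ)) f Finset.univ
  have hc := hasTemperateGrowth_coord (n := n)
  simp only [Coefficients.spatial, FourierTransform.fourier_add, hsum,
    FourierTransform.fourier_smul, fourier_lineDerivOp_single, map_smul]
  ext φ
  -- Multiplication is transposed onto the test function, where the symbol can be expanded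
  -- pointwise.
  have happ : TemperedDistribution.smulLeftCLM ℂ (L.symbol t) (𝓕 w) φ =
      𝓕 w ((∑ i, ∑ j, (L.a i j t : ℂ) •
          SchwartzMap.smulLeftCLM ℂ (fun ξ : Space n ↦ 2 * Real.pi * Complex.I * (ξ j : ℂ))
            (SchwartzMap.smulLeftCLM ℂ (fun ξ : Space n ↦ 2 * Real.pi * Complex.I * (ξ i : ℂ)) φ))
        + (∑ j, L.b j t •
          SchwartzMap.smulLeftCLM ℂ (fun ξ : Space n ↦ 2 * Real.pi * Complex.I * (ξ j : ℂ)) φ)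
        + L.c t • φ) := by
    rw [TemperedDistribution.smulLeftCLM_apply_apply]
    congr 1
    ext x
    simp only [SchwartzMap.smulLeftCLM_apply_apply (L.hasTemperateGrowth_symbol t),
      Coefficients.symbol, add_apply, sum_apply, smul_apply,
      SchwartzMap.smulLeftCLM_apply_apply (hc _), smul_eq_mul, add_mul, Finset.sum_mul]
    congr 3
    · funext i
      exact Finset.sum_congr rfl fun j _ ↦ by ring
    · funext j
      ring
  rw [happ]
  simp only [map_add, map_sum, map_smul, TemperedDistribution.smulLeftCLM_apply_apply,
    add_apply, sum_apply,
    smul_apply]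

/-- The product `q f` need not be in `L²`, but it is locally integrable because `q` is continuous;
testing against compactly supported smooth functions therefore determines it almost everywhere. -/
theorem ae_eq_neg_mul_of_add_smulLeftCLM_eq_zero {q : Space n → ℂ} (hq : q.HasTemperateGrowth)
    (f g : L2 n) (h : (g : TemperedDistribution (Space n) ℂ) +
      TemperedDistribution.smulLeftCLM ℂ q (f : TemperedDistribution (Space n) ℂ) = 0) :
    ∀ᵐ ξ, g ξ = -(q ξ * f ξ) := by
  have hg : LocallyIntegrable g := (Lp.memLp g).locallyIntegrable one_le_two
  have hf : LocallyIntegrable f := (Lp.memLp f).locallyIntegrable one_le_two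
  have hqc : Continuous q := hq.1.continuous
  have hqf : LocallyIntegrable (fun ξ ↦ q ξ * f ξ) := by
    simpa [smul_eq_mul] using hf.continuous_smul hqc
  have hzero : ∀ᵐ ξ, g ξ + q ξ * f ξ = 0 := by
    refine ae_eq_zero_of_integral_contDiff_smul_eq_zero (hg.add hqf) fun φ hφ hφc ↦ ?_
    have hφ₁ : HasCompactSupport (Complex.ofRealCLM ∘ φ) := hφc.comp_left rfl
    have hφ₂ : ContDiff ℝ (⊤ : ℕ∞) (Complex.ofRealCLM ∘ φ) := by fun_prop
    have happ := DFunLike.congr_fun h (hφ₁.toSchwartzMap hφ₂)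
    simp only [add_apply, TemperedDistribution.smulLeftCLM_apply_apply,
      Lp.toTemperedDistribution_apply, SchwartzMap.smulLeftCLM_apply_apply hq, zero_apply] at happ
    rw [← integral_add] at happ
    · rw [← happ]
      refine integral_congr_ae (ae_of_all _ fun ξ ↦ ?_)
      simp
      ring
    · simpa using hg.integrable_smul_left_of_hasCompactSupport hφ.continuous hφc
    · have := hqf.integrable_smul_left_of_hasCompactSupport hφ.continuous hφc
      refine this.congr (ae_of_all _ fun ξ ↦ ?_)
      simp
      ring
  filter_upwards [hzero] with ξ hξ
  exact eq_neg_of_add_eq_zero_left hξ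

theorem Coefficients.ae_fourier_eq (L : Coefficients n) {t : ℝ} (f g : L2 n)
    (h : (g : TemperedDistribution (Space n) ℂ) + L.spatial t f = 0) :
    ∀ᵐ ξ, (𝓕 g : L2 n) ξ = -(L.symbol t ξ * (𝓕 f : L2 n) ξ) := by
  refine ae_eq_neg_mul_of_add_smulLeftCLM_eq_zero (L.hasTemperateGrowth_symbol t) _ _ ?_
  have h' := congrArg (fun w : TemperedDistribution (Space n) ℂ ↦ 𝓕 w) h
  simp only [FourierTransform.fourier_add, L.fourier_spatial,
    Lp.fourier_toTemperedDistribution_eq] at h'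
  rw [h']
  exact map_zero (fourierCLM ℂ (TemperedDistribution (Space n) ℂ))

variable {L : Coefficients n} {T kA kB kC : ℝ} {ω : ℝ → ℝ}

/-- Since `(2πi)² = -4π²` and the `a i j` are real, the principal part is real and enters the growth
rate with the sign of the elliptic form. -/
theorem Coefficients.re_symbol (L : Coefficients n) (t : ℝ) (ξ : Space n) :
    -(L.symbol t ξ).re = 4 * Real.pi ^ 2 * (∑ i, ∑ j, L.a i j t * ξ i * ξ j) -
      ((∑ j, L.b j t * (2 * Real.pi * Complex.I * ξ j)) + L.c t).re := by
  have h : (∑ i, ∑ j, (L.a i j t : ℂ) *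
      ((2 * Real.pi * Complex.I * ξ i) * (2 * Real.pi * Complex.I * ξ j))) =
      ((-(4 * Real.pi ^ 2 * ∑ i, ∑ j, L.a i j t * ξ i * ξ j) : ℝ) : ℂ) := by
    push_cast
    rw [Finset.mul_sum, ← Finset.sum_neg_distrib]
    refine Finset.sum_congr rfl fun i _ ↦ ?_
    rw [Finset.mul_sum, ← Finset.sum_neg_distrib]
    refine Finset.sum_congr rfl fun j _ ↦ ?_
    linear_combination (4 * (Real.pi : ℂ) ^ 2 * L.a i j t * ξ i * ξ j) * Complex.I_sq
  rw [Coefficients.symbol, h, add_assoc, Complex.add_re, Complex.ofReal_re]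
  ring

theorem Coefficients.Admissible.abs_re_lower_order_le (hL : L.Admissible T kA kB kC ω) {t : ℝ}
    (ht : t ∈ Icc 0 T) (ξ : Space n) :
    |((∑ j, L.b j t * (2 * Real.pi * Complex.I * ξ j)) + L.c t).re| ≤
      2 * Real.pi * kB * n * ‖ξ‖ + kC := by
  refine (Complex.abs_re_le_norm _).trans ((norm_add_le _ _).trans ?_)
  refine add_le_add ((norm_sum_le _ _).trans ?_) (hL.bound_c t ht)
  have hj : ∀ j ∈ Finset.univ, ‖L.b j t * (2 * Real.pi * Complex.I * ξ j)‖ ≤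
      2 * Real.pi * kB * ‖ξ‖ := by
    intro j _
    have hξ : ‖ξ j‖ ≤ ‖ξ‖ := PiLp.norm_apply_le ξ j
    have hb := hL.bound_b t ht j
    have : ‖L.b j t‖ * ‖ξ j‖ ≤ kB * ‖ξ‖ :=
      mul_le_mul hb hξ (norm_nonneg _) ((norm_nonneg _).trans hb)
    rw [norm_mul, norm_mul, norm_mul, norm_mul, Complex.norm_I, Complex.norm_real,
      Complex.norm_real, Complex.norm_two, Real.norm_of_nonneg Real.pi_pos.le]
    nlinarith [Real.pi_pos]
  refine (Finset.sum_le_card_nsmul _ _ _ hj).trans (le_of_eq ?_)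
  simp
  ring

/-- The frequency beyond which the principal part of the symbol dominates the lower order terms. -/
noncomputable def frequencyThreshold (n : ℕ) (kA kB kC : ℝ) : ℝ :=
  max 1 ((2 * Real.pi * kB * n + kC) / (2 * Real.pi ^ 2 * kA))

/-- For `r ≥ 1` the left side is at most `(2π kB n + kC) r`, and the second entry of the maximum
absorbs this into half of the principal lower bound `4π² kA r²`. -/
theorem lower_order_le_of_frequencyThreshold_le (hkA : 0 < kA) (hkC : 0 ≤ kC) {r : ℝ}
    (hr : frequencyThreshold n kA kB kC ≤ r) :
    2 * Real.pi * kB * n * r + kC ≤ 2 * Real.pi ^ 2 * kA * r ^ 2 := by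
  have h1 : 1 ≤ r := (le_max_left _ _).trans hr
  have h2 := (le_max_right _ _).trans hr
  rw [div_le_iff₀ (by positivity)] at h2
  nlinarith

theorem Coefficients.Admissible.le_neg_re_symbol (hL : L.Admissible T kA kB kC ω)
    (hkA : 0 < kA) (hkC : 0 ≤ kC) {t : ℝ} (ht : t ∈ Icc 0 T) {R : ℝ}
    (hR : frequencyThreshold n kA kB kC ≤ R) {ξ : Space n} (hξ : R ≤ ‖ξ‖) :
    2 * Real.pi ^ 2 * kA * R ^ 2 ≤ -(L.symbol t ξ).re := by
  have h1 := (abs_le.mp (hL.abs_re_lower_order_le ht ξ)).2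
  have h2 := lower_order_le_of_frequencyThreshold_le hkA hkC (hR.trans hξ)
  have h3 := mul_le_mul_of_nonneg_left (hL.lower t ht ξ) (by positivity : 0 ≤ 4 * Real.pi ^ 2)
  have hR0 : 0 ≤ R := zero_le_one.trans ((le_max_left _ _).trans hR)
  have h4 : 2 * Real.pi ^ 2 * kA * R ^ 2 ≤ 2 * Real.pi ^ 2 * kA * ‖ξ‖ ^ 2 := by gcongr
  rw [L.re_symbol]
  linarith

theorem Coefficients.Admissible.neg_re_symbol_le (hL : L.Admissible T kA kB kC ω)
    (hkA : 0 < kA) (hkB : 0 ≤ kB) (hkC : 0 ≤ kC) {t : ℝ} (ht : t ∈ Icc 0 T) {R : ℝ}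
    (hR : frequencyThreshold n kA kB kC ≤ R) {ξ : Space n} (hξ : ‖ξ‖ ≤ R) :
    -(L.symbol t ξ).re ≤ (4 * Real.pi ^ 2 * kA⁻¹ + 2 * Real.pi ^ 2 * kA) * R ^ 2 := by
  have h1 := (abs_le.mp (hL.abs_re_lower_order_le ht ξ)).1
  have h2 := lower_order_le_of_frequencyThreshold_le hkA hkC hR
  have h3 := mul_le_mul_of_nonneg_left (hL.upper t ht ξ) (by positivity : 0 ≤ 4 * Real.pi ^ 2)
  have h4 : 4 * Real.pi ^ 2 * (kA⁻¹ * ‖ξ‖ ^ 2) ≤ 4 * Real.pi ^ 2 * (kA⁻¹ * R ^ 2) := by gcongr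
  -- Small `ξ` may lie below the threshold, so the lower order bound is first increased to its value
  -- at `R`, where it is absorbed.
  have h5 : 2 * Real.pi * kB * n * ‖ξ‖ ≤ 2 * Real.pi * kB * n * R := by gcongr
  rw [L.re_symbol]
  linarith

end Symbol

/-! ### Energy estimates for low and high frequencies -/

section Energy

variable {n : ℕ} {L : Coefficients n} {T kA kB kC : ℝ} {ω : ℝ → ℝ} {u : ℝ → L2 n}

/-- The restriction of the Fourier transform to a set of frequencies. -/
noncomputable def fourierRestrict (S : Set (Space n)) :
    L2 n →L[ℂ] Lp ℂ 2 ((volume : Measure (Space n)).restrict S) :=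
  (LpToLpRestrictCLM (Space n) ℂ ℂ volume 2 S).comp (fourierCLM ℂ (L2 n))

theorem norm_sq_fourierRestrict_add_compl (f : L2 n) {S : Set (Space n)} (hS : MeasurableSet S) :
    ‖fourierRestrict S f‖ ^ 2 + ‖fourierRestrict Sᶜ f‖ ^ 2 = ‖f‖ ^ 2 :=
  (norm_sq_restrict_add_compl _ hS).trans (congrArg (· ^ 2) (Lp.norm_fourier_eq f))

theorem norm_fourierRestrict_le (S : Set (Space n)) (hS : MeasurableSet S) (f : L2 n) :
    ‖fourierRestrict S f‖ ^ 2 ≤ ‖f‖ ^ 2 := by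
  nlinarith [norm_sq_fourierRestrict_add_compl f hS, sq_nonneg ‖fourierRestrict Sᶜ f‖]

/-- Only the real part of the symbol changes `|û|`; the imaginary part rotates the phase. -/
theorem Coefficients.ae_re_inner_fourierRestrict (L : Coefficients n) {t : ℝ} (S : Set (Space n))
    (f g : L2 n) (h : (g : TemperedDistribution (Space n) ℂ) + L.spatial t f = 0) :
    ∀ᵐ ξ ∂(volume.restrict S), (inner ℂ (fourierRestrict S f ξ) (fourierRestrict S g ξ)).re =
      -(L.symbol t ξ).re * ‖fourierRestrict S f ξ‖ ^ 2 := by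
  filter_upwards [ae_restrict_of_ae (L.ae_fourier_eq f g h),
    LpToLpRestrictCLM_coeFn ℂ S (𝓕 f : L2 n), LpToLpRestrictCLM_coeFn ℂ S (𝓕 g : L2 n)]
    with ξ h1 h2 h3
  have h2' : fourierRestrict S f ξ = (𝓕 f : L2 n) ξ := h2
  have h3' : fourierRestrict S g ξ = (𝓕 g : L2 n) ξ := h3
  have h4 : inner ℂ ((𝓕 f : L2 n) ξ) ((𝓕 f : L2 n) ξ) = ((‖(𝓕 f : L2 n) ξ‖ ^ 2 : ℝ) : ℂ) := by
    simp
  rw [h2', h3', h1, ← neg_mul, ← smul_eq_mul, inner_smul_right, h4, Complex.re_mul_ofReal,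
    Complex.neg_re]

theorem monotoneOn_high_frequency (hkA : 0 < kA) (hkC : 0 ≤ kC)
    (hL : L.Admissible T kA kB kC ω) (hu : MemH0 T u) (hsol : L.IsSolution T u) {R : ℝ}
    (hR : frequencyThreshold n kA kB kC ≤ R) :
    MonotoneOn (fun t ↦ Real.exp (-(2 * (2 * Real.pi ^ 2 * kA * R ^ 2) * t)) *
      ‖fourierRestrict (Metric.closedBall 0 R)ᶜ (u t)‖ ^ 2) (Icc 0 T) := by
  refine monotoneOn_exp_mul_norm_sq _ hu.continuousOn hu.contDiffOn ?_
  filter_upwards [hsol] with t hsol ht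
  refine mul_norm_sq_le_re_inner _ _ ?_
  filter_upwards [L.ae_re_inner_fourierRestrict (Metric.closedBall 0 R)ᶜ _ _ (hsol ht),
    ae_restrict_mem Metric.isClosed_closedBall.measurableSet.compl] with ξ hξ hmem
  refine (mul_le_mul_of_nonneg_right ?_ (sq_nonneg _)).trans_eq hξ.symm
  refine hL.le_neg_re_symbol hkA hkC (Ioo_subset_Icc_self ht) hR ?_
  simpa using (not_le.mp (by simpa using hmem) : R < ‖ξ‖).le

theorem antitoneOn_low_frequency (hkA : 0 < kA) (hkB : 0 ≤ kB) (hkC : 0 ≤ kC)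
    (hL : L.Admissible T kA kB kC ω) (hu : MemH0 T u) (hsol : L.IsSolution T u) {R : ℝ}
    (hR : frequencyThreshold n kA kB kC ≤ R) :
    AntitoneOn (fun t ↦
      Real.exp (-(2 * ((4 * Real.pi ^ 2 * kA⁻¹ + 2 * Real.pi ^ 2 * kA) * R ^ 2) * t)) *
      ‖fourierRestrict (Metric.closedBall 0 R) (u t)‖ ^ 2) (Icc 0 T) := by
  refine antitoneOn_exp_mul_norm_sq _ hu.continuousOn hu.contDiffOn ?_
  filter_upwards [hsol] with t hsol ht
  refine re_inner_le_mul_norm_sq _ _ ?_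
  filter_upwards [L.ae_re_inner_fourierRestrict (Metric.closedBall 0 R) _ _ (hsol ht),
    ae_restrict_mem Metric.isClosed_closedBall.measurableSet] with ξ hξ hmem
  refine hξ.trans_le (mul_le_mul_of_nonneg_right ?_ (sq_nonneg _))
  exact hL.neg_re_symbol_le hkA hkB hkC (Ioo_subset_Icc_self ht) hR (by simpa using hmem)

/-- The two-sided energy estimate: low frequencies are controlled from time `0`, high frequencies
from time `T`. Since the coefficients depend on time only, the Fourier transform diagonalises the
equation, and ellipticity together with the bounds on the coefficients suffices; the modulus of
continuity plays no role. -/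
theorem norm_sq_le_of_frequencyThreshold_le (hkA : 0 < kA) (hkB : 0 ≤ kB) (hkC : 0 ≤ kC)
    (hL : L.Admissible T kA kB kC ω) (hu : MemH0 T u) (hsol : L.IsSolution T u) {R T' D t : ℝ}
    (hR : frequencyThreshold n kA kB kC ≤ R) (hT' : T' < T) (hD : ‖u T‖ ≤ D)
    (ht : t ∈ Icc 0 T') :
    ‖u t‖ ^ 2 ≤
      Real.exp (2 * T * (4 * Real.pi ^ 2 * kA⁻¹ + 2 * Real.pi ^ 2 * kA) * R ^ 2) * ‖u 0‖ ^ 2 +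
      D ^ 2 * Real.exp (-(2 * (T - T') * (2 * Real.pi ^ 2 * kA) * R ^ 2)) := by
  have hT : 0 ≤ T := ht.1.trans (ht.2.trans hT'.le)
  have htT : t ∈ Icc 0 T := ⟨ht.1, ht.2.trans hT'.le⟩
  have hball := (Metric.isClosed_closedBall (x := (0 : Space n)) (ε := R)).measurableSet
  have hlow := antitoneOn_low_frequency hkA hkB hkC hL hu hsol hR (left_mem_Icc.mpr hT) htT ht.1
  have hhigh := monotoneOn_high_frequency hkA hkC hL hu hsol hR htT (right_mem_Icc.mpr hT) htT.2
  have h0 := norm_fourierRestrict_le _ hball (u 0)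
  have h1 := norm_fourierRestrict_le _ hball.compl (u T)
  have h2 : ‖u T‖ ^ 2 ≤ D ^ 2 := by gcongr
  simp only [mul_zero, neg_zero, Real.exp_zero, one_mul] at hlow
  beta_reduce at hhigh
  set K := 4 * Real.pi ^ 2 * kA⁻¹ + 2 * Real.pi ^ 2 * kA
  have hK : 0 ≤ K := by positivity
  rw [← norm_sq_fourierRestrict_add_compl (u t) hball]
  refine add_le_add ?_ ?_
  · rw [Real.exp_neg, inv_mul_le_iff₀ (Real.exp_pos _)] at hlow
    refine hlow.trans (mul_le_mul (Real.exp_le_exp.mpr ?_) h0 (sq_nonneg _) (Real.exp_pos _).le)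
    have : K * R ^ 2 * t ≤ K * R ^ 2 * T := mul_le_mul_of_nonneg_left htT.2 (by positivity)
    linarith
  · rw [Real.exp_neg, inv_mul_le_iff₀ (Real.exp_pos _), ← mul_assoc, ← Real.exp_add] at hhigh
    refine hhigh.trans ((mul_le_mul (Real.exp_le_exp.mpr ?_) (h1.trans h2) (sq_nonneg _)
      (Real.exp_pos _).le).trans_eq (mul_comm _ _))
    have : 2 * Real.pi ^ 2 * kA * R ^ 2 * t ≤ 2 * Real.pi ^ 2 * kA * R ^ 2 * T' :=
      mul_le_mul_of_nonneg_left ht.2 (by positivity)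
    linarith

end Energy

/-! ### Optimisation of the cut-off and the final estimate -/

/-- Choosing the frequency cut-off `R` in terms of `s` turns the sum of the two exponential terms
into a power of `s`. -/
theorem le_sqrt_add_mul_rpow {K c T D x m R₀ : ℝ} (hK : 0 < K) (hT : 0 < T)
    (hm : 0 ≤ m)
    (h : ∀ R, R₀ ≤ R → x ≤ Real.exp (2 * T * K * R ^ 2) * m + D ^ 2 * Real.exp (-(c * R ^ 2)))
    (hmR : m ≤ Real.exp (-(2 * T * K * R₀ ^ 2)) ^ 2) (hc : 0 < c) :
    x ≤ √m + D ^ 2 * m ^ (c / (4 * T * K)) := by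
  -- A parameter `s ≥ m` replaces `m` because `log m` is of no use when `m = 0`.
  have hpos : ∀ s : ℝ, 0 < s → m ≤ s → s ≤ Real.exp (-(2 * T * K * R₀ ^ 2)) ^ 2 →
      x ≤ √s + D ^ 2 * s ^ (c / (4 * T * K)) := by
    intro s hs hms hsR
    rw [← Real.exp_nat_mul, ← Real.log_le_iff_le_exp hs] at hsR
    push_cast at hsR
    -- With `R² = -log s / (4TK)` one has `exp (2TKR²) = s^(-1/2)` and `exp (-cR²) = s^(c/(4TK))`;
    -- the upper bound on `s` says exactly that this `R²` is at least `R₀²`.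
    have hX : R₀ ^ 2 ≤ -Real.log s / (4 * T * K) := by
      rw [le_div_iff₀ (by positivity)]
      linarith
    have hsq : √(-Real.log s / (4 * T * K)) ^ 2 = -Real.log s / (4 * T * K) :=
      Real.sq_sqrt ((sq_nonneg _).trans hX)
    refine (h _ (Real.le_sqrt_of_sq_le hX)).trans (add_le_add ?_ ?_)
    · rw [hsq, show 2 * T * K * (-Real.log s / (4 * T * K)) = -(Real.log s / 2) by field_simp; ring,
        Real.exp_neg, ← Real.log_sqrt hs.le, Real.exp_log (Real.sqrt_pos.mpr hs),
        inv_mul_le_iff₀ (Real.sqrt_pos.mpr hs), Real.mul_self_sqrt hs.le]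
      exact hms
    · rw [hsq, Real.rpow_def_of_pos hs]
      refine mul_le_mul_of_nonneg_left (Real.exp_le_exp.mpr (le_of_eq ?_)) (sq_nonneg _)
      ring
  rcases hm.eq_or_lt with rfl | hm'
  -- For `m = 0` every small `s > 0` is allowed, and `s → 0⁺` gives the bound.
  · have hcont : ContinuousAt (fun s : ℝ ↦ √s + D ^ 2 * s ^ (c / (4 * T * K))) 0 :=
      Real.continuous_sqrt.continuousAt.add
        (continuousAt_const.mul (Real.continuousAt_rpow_const _ _ (Or.inr (by positivity))))
    refine ge_of_tendsto (hcont.tendsto.mono_left (nhdsWithin_le_nhds (s := Ioi 0))) ?_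
    filter_upwards [Ioc_mem_nhdsGT (show (0 : ℝ) < Real.exp (-(2 * T * K * R₀ ^ 2)) ^ 2 by positivity)]
      with s hs
    exact hpos s hs.1 hs.1.le hs.2
  · exact hpos m hm' le_rfl hmR

end BackwardParabolic

theorem mainTheorem1 (n : ℕ) (kA kB kC T T' D : ℝ) (ω : ℝ → ℝ)
    (hkA : 0 < kA) (hkB : 0 < kB) (hkC : 0 < kC)
    (hω : BackwardParabolic.IsModulusOfContinuity ω)
    (hO : BackwardParabolic.OsgoodCondition ω)
    (hT' : 0 < T') (hT'T : T' < T) (hD : 0 < D) :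
    ∃ ρ' : ℝ, 0 < ρ' ∧ ∃ G : ℝ≥0 → ℝ≥0, StrictMono G ∧ Continuous G ∧ G 0 = 0 ∧
      ∀ L : BackwardParabolic.Coefficients n, L.Admissible T kA kB kC ω →
        ∀ u : ℝ → BackwardParabolic.L2 n, BackwardParabolic.MemH0 T u → L.IsSolution T u →
          (∀ t ∈ Set.Icc 0 T, ‖u t‖ ≤ D) → ‖u 0‖ ≤ ρ' →
            (⨆ t ∈ Set.Icc 0 T', ‖u t‖ₑ ^ 2) ≤ (G (‖u 0‖₊ ^ 2) : ℝ≥0∞) := by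
  have hT : 0 < T := hT'.trans hT'T
  set K := 4 * Real.pi ^ 2 * kA⁻¹ + 2 * Real.pi ^ 2 * kA
  have hK : 0 < K := by positivity
  set c := 2 * (T - T') * (2 * Real.pi ^ 2 * kA)
  have hc : 0 < c := by
    have := sub_pos.mpr hT'T
    positivity
  set R₀ := BackwardParabolic.frequencyThreshold n kA kB kC
  have hγ : 0 < c / (4 * T * K) := by positivity
  -- The condition `‖u 0‖ ≤ ρ'` is what makes the optimal cut-off admissible, that is, at least
  -- `R₀`. The square root alone makes `G` strictly increasing.
  refine ⟨Real.exp (-(2 * T * K * R₀ ^ 2)), Real.exp_pos _,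
    fun s ↦ NNReal.sqrt s + (D ^ 2).toNNReal * s ^ (c / (4 * T * K)), ?_, ?_, ?_, ?_⟩
  · intro s₁ s₂ hs
    exact add_lt_add_of_lt_of_le (NNReal.sqrt_lt_sqrt.mpr hs)
      (mul_le_mul_right (NNReal.rpow_le_rpow hs.le hγ.le) _)
  · exact NNReal.continuous_sqrt.add (continuous_const.mul (NNReal.continuous_rpow_const hγ.le))
  · simp [NNReal.zero_rpow hγ.ne']
  · intro L hL u hu hsol hbound hρ
    refine iSup₂_le fun t ht ↦ ?_
    have h : ‖u t‖ ^ 2 ≤ √(‖u 0‖ ^ 2) + D ^ 2 * (‖u 0‖ ^ 2) ^ (c / (4 * T * K)) :=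
      BackwardParabolic.le_sqrt_add_mul_rpow hK hT (sq_nonneg _)
        (fun R hR ↦ BackwardParabolic.norm_sq_le_of_frequencyThreshold_le hkA hkB.le hkC.le hL hu
          hsol hR hT'T (hbound T (Set.right_mem_Icc.mpr hT.le)) ht)
        (by gcongr) hc
    rw [enorm_eq_nnnorm, ← ENNReal.coe_pow, ENNReal.coe_le_coe, ← NNReal.coe_le_coe]
    simpa [Real.coe_toNNReal _ (sq_nonneg D)] using h
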